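/- For a word $\beta\in\{0,1\}^*$ let $\mathcal{P}_\beta$ be the undirected path on $|\beta|$ vertices whose $i$-th vertex carries a loop if and only if the $i$-th letter of $\beta$ is $1$. A \emph{partially reflexive path} is a graph $\mathcal{H}$ isomorphic to some $\mathcal{P}_\beta$; we then say that $\mathcal{H}$ is \emph{of the form} $\beta$ (so a path is of the form $\beta$ if and only if it is of the form of the reversal of $\beta$). Such an $\mathcal{H}$ is \emph{quasi-loop-connected} if it is of the form $0^a1^b\alpha$ for some $a\ge 0$, $b>0$ and $\alpha\in\{0,1\}^*$ with $|\alpha|=a$, or of the form $0^a\alpha$ for some $a\ge 0$ and $\alpha\in\{0,1\}^*$ with $|\alpha|\in\{a,a-1\}$. Let $\mathrm{id\text{-}Pol}(\mathcal{H})$ be the algebra whose domain is the vertex set $H$ and whose operations are all operations $f:H^k\to H$, $k\ge 1$, that are graph homomorphisms $\mathcal{H}^k\to\mathcal{H}$ (adjacency in $\mathcal{H}^k$ being coordinatewise) and satisfy $f(x,\dots,x)=x$ for all $x\in H$; equivalently, all polymorphisms of $\mathcal{H}$ expanded with a constant for each of its vertices. For an algebra $\mathbb{A}$ with finite domain and $m\ge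 1$ let $f_{\mathbb{A}}(m)$ be the least size of a generating set of the direct power $\mathbb{A}^m$. The algebra $\mathbb{A}$ has the \emph{polynomially generated powers property} (PGP) if $f_{\mathbb{A}}=O(p)$ for some polynomial $p$, and the \emph{exponentially generated powers property} (EGP) if there is a constant $b>1$ with $f_{\mathbb{A}}(m)=\Omega(b^m)$. \textbf{Theorem.} Let $\mathcal{H}$ be a partially reflexive path. If $\mathcal{H}$ is quasi-loop-connected, then $\mathrm{id\text{-}Pol}(\mathcal{H})$ has the PGP. Otherwise, $\mathrm{id\text{-}Pol}(\mathcal{H})$ has the EGP. -/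

import Mathlib

open Filter Asymptotics

/-! ### Partially reflexive paths -/

/-- The edge relation of the undirected path `P_β` on `|β|` vertices, for a word `β` over `{0,1}`
(`false` is `0`, `true` is `1`): consecutive vertices are adjacent, and the `i`-th vertex has a
loop iff the `i`-th letter of `β` is `1`. -/
def pathEdge (β : List Bool) (i j : Fin β.length) : Prop :=
  (i : ℕ) + 1 = j ∨ (j : ℕ) + 1 = i ∨ (i = j ∧ β.get i = true)

/-- The path with edge relation `E` is of the form `β`: it is isomorphic to `P_β`. Since the path
is undirected, its vertices may be read off in either of the two directions. -/
def IsOfForm {V : Type*} (E : V → V → Prop) (β : List Bool) : Prop :=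
  Nonempty (E ≃r pathEdge β)

/-- `E` is the edge relation of a partially reflexive path. -/
def IsPartiallyReflexivePath {V : Type*} (E : V → V → Prop) : Prop :=
  ∃ β : List Bool, IsOfForm E β

/-- `E` is of the form `0^a 1^b α` with `b > 0` and `|α| = a`, or of the form `0^a α` with
`|α| ∈ {a, a - 1}`. -/
def IsQuasiLoopConnected {V : Type*} (E : V → V → Prop) : Prop :=
  (∃ (a b : ℕ) (α : List Bool), 0 < b ∧ α.length = a ∧
      IsOfForm E (List.replicate a false ++ List.replicate b true ++ α)) ∨
  (∃ (a : ℕ) (α : List Bool), (α.length = a ∨ α.length + 1 = a) ∧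
      IsOfForm E (List.replicate a false ++ α))

/-! ### Algebras and generating sets of their powers -/

/-- An algebra on the domain `A`, given by its set of `k`-ary operations for every `k`. -/
abbrev OperationSet (A : Type*) : Type _ := ∀ k : ℕ, Set ((Fin k → A) → A)

/-- `S` is (the domain of) a subalgebra of the `m`-th power of the algebra `𝔸`: it is closed under
all operations of `𝔸`, acting coordinatewise on `m`-tuples. -/
def IsSubalgebraOfPower {A : Type*} (𝔸 : OperationSet A) (m : ℕ) (S : Set (Fin m → A)) : Prop :=
  ∀ (k : ℕ), ∀ f ∈ 𝔸 k, ∀ t : Fin k → (Fin m → A), (∀ i, t i ∈ S) →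
    (fun j : Fin m => f (fun i : Fin k => t i j)) ∈ S

/-- `Γ` is a generating set of the `m`-th power of `𝔸`: the smallest subalgebra containing `Γ`
is everything. -/
def GeneratesPower {A : Type*} (𝔸 : OperationSet A) (m : ℕ) (Γ : Set (Fin m → A)) : Prop :=
  ⋂₀ {S : Set (Fin m → A) | Γ ⊆ S ∧ IsSubalgebraOfPower 𝔸 m S} = Set.univ

/-- The least cardinality of a generating set of the `m`-th power of `𝔸`, for a finite domain
(where the full power is itself a finite generating set). -/
noncomputable def generatingNumber {A : Type*} (𝔸 : OperationSet A) (m : ℕ) : ℕ :=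
  sInf {c : ℕ | ∃ Γ : Finset (Fin m → A), Γ.card = c ∧ GeneratesPower 𝔸 m (Γ : Set (Fin m → A))}

/-- The polynomially generated powers property. -/
def HasPGP {A : Type*} (𝔸 : OperationSet A) : Prop :=
  ∃ p : Polynomial ℝ,
    (fun m : ℕ => (generatingNumber 𝔸 m : ℝ)) =O[atTop] fun m : ℕ => p.eval (m : ℝ)

/-- The exponentially generated powers property: `f = Ω(b ^ m)` for some base `b > 1`. -/
def HasEGP {A : Type*} (𝔸 : OperationSet A) : Prop :=
  ∃ b : ℝ, 1 < b ∧
    (fun m : ℕ => b ^ m) =O[atTop] fun m : ℕ => (generatingNumber 𝔸 m : ℝ)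

/-! ### Idempotent polymorphisms -/

/-- `f` is a `k`-ary polymorphism of the digraph `E`: a homomorphism from its `k`-th power. -/
def IsPolymorphism {V : Type*} (E : V → V → Prop) {k : ℕ} (f : (Fin k → V) → V) : Prop :=
  ∀ x y : Fin k → V, (∀ i, E (x i) (y i)) → E (f x) (f y)

/-- `f (v, …, v) = v` for all `v`; equivalently, `f` preserves every constant naming an element. -/
def IsIdempotentOperation {V : Type*} {k : ℕ} (f : (Fin k → V) → V) : Prop :=
  ∀ v : V, f (fun _ => v) = v

/-- The algebra `id-Pol` of all idempotent polymorphisms (of positive arity) of the digraph `E`,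
that is, of all polymorphisms of the digraph expanded with a constant for each of its vertices. -/
def idPol {V : Type*} (E : V → V → Prop) : OperationSet V :=
  fun k => {f | 0 < k ∧ IsPolymorphism E f ∧ IsIdempotentOperation f}

/-!
The dichotomy is decided by the first block `[a, c]` of loops of the path `0, …, n - 1`, read in one
of the two directions: the path is quasi-loop-connected iff it has no loop, or at most `a` vertices
lie to the right of `c` in a suitable direction.

*Polynomial case.* Suppose that a ternary idempotent polymorphism `f` takes each value in `D \ P` on
arguments from `D` one of which, at any prescribed position, lies in `P`. Then a tuple with three
entries in `D \ P` is the image under `f` of three tuples with fewer such entries, and so the power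
is generated by the tuples with at most two of them (`mem_subalgebra_of_reduction`). On a loopless
path, the maximum rounded down to the majority parity reduces all entries to `0`. Otherwise two
operations are used. The operation `crossing` reduces all but two entries to `[0, c]`: two arguments
of different parity in `[0, a]` have to pass a loop before they can meet again below `a`, and this
detour leaves room to map them to any of the at most `a` vertices to the right of `c`.
Then `liftMax`, a maximum corrected by parity, reduces all but two entries in `[0, c]` to `0`. Hence
the polynomially many tuples with at most four nonzero entries generate everything
(`hasPGP_of_reductions`).

*Exponential case.* Let `x < y` be consecutive loops with `x + 2 ≤ y`. On tuples over `{x, y}` an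
idempotent polymorphism has values in `{x, y}`, and it is a projection there, since two independent
ways of changing the value could be started simultaneously and would yield adjacent tuples with the
same loopless value (`IsIntPolymorphism.exists_isProjOn`). Consecutive gaps use the same coordinate
`i` (`IsIntPolymorphism.isProjOn_adjacent`), so all gaps do. If more than `l` vertices lie to the
right of the first block `[l, c]`, then a tuple whose `i`-th entry is not `n - 1` walks to a tuple
of value at most `c` in `n - 2 - c` steps, and so its own value is not `n - 1`
(`IsIntPolymorphism.ne_last`). With the same argument from the other end, every idempotent
polymorphism takes the values `0` and `n - 1` only where its `i`-th argument does. So no tuple over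
`{0, n - 1}` is generated by other tuples, and every generating set of the `m`-th power has at least
`2 ^ m` elements (`two_pow_le_generatingNumber`).
-/

/-! ### Integer coordinates on a path -/

/-- Adjacency of integers in the two-way infinite path whose loops are given by `lp`. -/
def PathAdj (lp : ℤ → Prop) (x y : ℤ) : Prop :=
  x + 1 = y ∨ y + 1 = x ∨ (x = y ∧ lp x)

/-- `pos` identifies the graph `E` with the induced subgraph on `[0, n)` of the integer path whose
loops are given by `lp`; values of `lp` outside `[0, n)` are irrelevant. -/
structure PathCoords {V : Type*} (E : V → V → Prop) (n : ℕ) (lp : ℤ → Prop) (pos : V → ℤ) :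
    Prop where
  nonneg : ∀ v, 0 ≤ pos v
  lt : ∀ v, pos v < n
  inj : Function.Injective pos
  surj : ∀ z : ℤ, 0 ≤ z → z < n → ∃ v, pos v = z
  edge : ∀ u v, E u v ↔ PathAdj lp (pos u) (pos v)

/-- The `z`-th letter of the word `γ` is `1`. -/
def loopAt (γ : List Bool) (z : ℤ) : Prop := γ[z.toNat]? = some true

theorem pathEdge_iff (γ : List Bool) (i j : Fin γ.length) :
    pathEdge γ i j ↔ PathAdj (loopAt γ) (i : ℕ) (j : ℕ) := by
  unfold pathEdge PathAdj loopAt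
  rw [Fin.ext_iff]
  refine or_congr (by omega) (or_congr (by omega) (and_congr (by omega) ?_))
  simp

theorem IsOfForm.exists_pathCoords {V : Type*} {E : V → V → Prop} {γ : List Bool}
    (h : IsOfForm E γ) : ∃ pos, PathCoords E γ.length (loopAt γ) pos := by
  obtain ⟨e⟩ := h
  refine ⟨fun v => ((e v : ℕ) : ℤ), fun v => by positivity, fun v => ?_, ?_, ?_, ?_⟩
  · exact_mod_cast (e v).isLt
  · intro u v huv
    apply e.injective
    apply Fin.ext
    have huv' : ((e u : ℕ) : ℤ) = ((e v : ℕ) : ℤ) := huv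
    exact_mod_cast huv'
  · intro z h0 h1
    refine ⟨e.symm ⟨z.toNat, by omega⟩, ?_⟩
    simp [h0]
  · intro u v
    rw [← e.map_rel_iff, pathEdge_iff]

theorem PathCoords.isOfForm {V : Type*} {E : V → V → Prop} {n : ℕ} {lp : ℤ → Prop} {pos : V → ℤ}
    (h : PathCoords E n lp pos) {γ : List Bool} (hn : γ.length = n)
    (hγ : ∀ z : ℤ, 0 ≤ z → z < n → (lp z ↔ loopAt γ z)) : IsOfForm E γ := by
  let g : V → Fin γ.length := fun v =>
    ⟨(pos v).toNat, by have := h.nonneg v; have := h.lt v; omega⟩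
  have hg : ∀ v, ((g v : ℕ) : ℤ) = pos v := fun v => Int.toNat_of_nonneg (h.nonneg v)
  have hb : Function.Bijective g := by
    constructor
    · intro u v huv
      apply h.inj
      rw [← hg u, ← hg v, huv]
    · intro i
      obtain ⟨v, hv⟩ := h.surj (i : ℕ) (by positivity) (by have := i.isLt; omega)
      refine ⟨v, Fin.ext ?_⟩
      have := hg v
      omega
  refine ⟨⟨Equiv.ofBijective g hb, ?_⟩⟩
  intro u v
  change pathEdge γ (g u) (g v) ↔ E u v
  rw [pathEdge_iff, h.edge, hg, hg]
  unfold PathAdj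
  rw [hγ _ (h.nonneg u) (h.lt u)]

/-- Reading a path in the opposite direction. -/
theorem PathCoords.reverse {V : Type*} {E : V → V → Prop} {n : ℕ} {lp : ℤ → Prop} {pos : V → ℤ}
    (h : PathCoords E n lp pos) :
    PathCoords E n (fun z => lp (n - 1 - z)) (fun v => n - 1 - pos v) where
  nonneg v := by have := h.lt v; omega
  lt v := by have := h.nonneg v; omega
  inj u v huv := h.inj (by simpa using huv)
  surj z h0 h1 := by
    obtain ⟨v, hv⟩ := h.surj (n - 1 - z) (by omega) (by omega)
    exact ⟨v, by omega⟩
  edge u v := by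
    rw [h.edge]
    unfold PathAdj
    simp only [sub_sub_cancel]
    constructor
    · rintro (h | h | ⟨h, h'⟩)
      · right; left; omega
      · left; omega
      · exact Or.inr (Or.inr ⟨by omega, h'⟩)
    · rintro (h | h | ⟨h, h'⟩)
      · right; left; omega
      · left; omega
      · exact Or.inr (Or.inr ⟨by omega, h'⟩)

theorem PathCoords.finite {V : Type*} {E : V → V → Prop} {n : ℕ} {lp : ℤ → Prop} {pos : V → ℤ}
    (h : PathCoords E n lp pos) : Finite V := by
  refine Finite.of_injective (fun v => (⟨pos v, h.nonneg v, h.lt v⟩ : Set.Ico (0 : ℤ) n)) ?_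
  intro u v huv
  exact h.inj (congrArg Subtype.val huv)

/-- `F` acts on tuples over `[0, n)` as an idempotent polymorphism of the path on `[0, n)` with
loops `lp`; its values elsewhere are irrelevant. -/
structure IsIntPolymorphism (n : ℤ) (lp : ℤ → Prop) {k : ℕ} (F : (Fin k → ℤ) → ℤ) : Prop where
  mem : ∀ w, (∀ j, 0 ≤ w j ∧ w j < n) → 0 ≤ F w ∧ F w < n
  hom : ∀ w w', (∀ j, 0 ≤ w j ∧ w j < n) → (∀ j, 0 ≤ w' j ∧ w' j < n) →
    (∀ j, PathAdj lp (w j) (w' j)) → PathAdj lp (F w) (F w')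
  idem : ∀ v, 0 ≤ v → v < n → F (fun _ => v) = v

theorem PathCoords.exists_idPol {V : Type*} {E : V → V → Prop} {n : ℕ} {lp : ℤ → Prop}
    {pos : V → ℤ} (h : PathCoords E n lp pos) {k : ℕ} (hk : 0 < k) {F : (Fin k → ℤ) → ℤ}
    (hF : IsIntPolymorphism n lp F) :
    ∃ f ∈ idPol E k, ∀ w, pos (f w) = F (fun j => pos (w j)) := by
  have hr : ∀ w : Fin k → V, ∀ j, 0 ≤ pos (w j) ∧ pos (w j) < n :=
    fun w j => ⟨h.nonneg _, h.lt _⟩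
  have hs : ∀ w : Fin k → V, ∃ v, pos v = F (fun j => pos (w j)) := fun w =>
    h.surj _ (hF.mem _ (hr w)).1 (hF.mem _ (hr w)).2
  choose f hf using hs
  refine ⟨f, ⟨hk, ?_, ?_⟩, hf⟩
  · intro x y hxy
    rw [h.edge, hf, hf]
    exact hF.hom _ _ (hr x) (hr y) fun j => (h.edge _ _).1 (hxy j)
  · intro v
    apply h.inj
    rw [hf]
    exact hF.idem _ (h.nonneg v) (h.lt v)

theorem PathCoords.exists_isIntPolymorphism {V : Type*} {E : V → V → Prop} {n : ℕ}
    {lp : ℤ → Prop} {pos : V → ℤ} (h : PathCoords E n lp pos) {k : ℕ} {f : (Fin k → V) → V}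
    (hf : f ∈ idPol E k) :
    ∃ F : (Fin k → ℤ) → ℤ, IsIntPolymorphism n lp F ∧
      ∀ w, F (fun j => pos (w j)) = pos (f w) := by
  rcases isEmpty_or_nonempty V with hV | hV
  · have hn : n = 0 := by
      by_contra hn
      obtain ⟨v, -⟩ := h.surj 0 le_rfl (by omega)
      exact hV.elim v
    subst hn
    have hk : Nonempty (Fin k) := ⟨⟨0, hf.1⟩⟩
    refine ⟨fun _ => 0, ⟨?_, ?_, ?_⟩, ?_⟩
    · intro w hw; have := hw hk.some; simp at this; omega
    · intro w w' hw; have := hw hk.some; simp at this; omega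
    · intro v h0 h1; simp at h1; omega
    · intro w; exact hV.elim (w hk.some)
  let vert : ℤ → V := Function.invFun pos
  have hat : ∀ z : ℤ, 0 ≤ z ∧ z < n → pos (vert z) = z := fun z hz =>
    Function.invFun_eq (h.surj z hz.1 hz.2)
  have hta : ∀ v, vert (pos v) = v := Function.leftInverse_invFun h.inj
  refine ⟨fun w => pos (f fun j => vert (w j)), ⟨?_, ?_, ?_⟩, ?_⟩
  · intro w _; exact ⟨h.nonneg _, h.lt _⟩
  · intro w w' hw hw' hww
    rw [← h.edge]
    apply hf.2.1
    intro j
    rw [h.edge, hat _ (hw j), hat _ (hw' j)]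
    exact hww j
  · intro v h0 h1
    rw [hf.2.2, hat v ⟨h0, h1⟩]
  · intro w
    simp only [hta]

/-! ### Generating powers by tuples that are almost constant -/

/-- If `f` is an idempotent ternary operation of the algebra and each element of `D \ P` is a value
of `f` on arguments from `D` whose `i`-th one lies in `P`, for every `i`, then every tuple is
generated by tuples that agree with it outside `D` and have at most two entries in `D \ P`:
when three entries of a tuple `t` lie in `D \ P`, then `t = f (t₀, t₁, t₂)` where the `i`-th of
these entries has been moved into `P` in `tᵢ`. -/
theorem mem_subalgebra_of_reduction {V : Type*} {𝔸 : OperationSet V} {f : (Fin 3 → V) → V}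
    (hf : f ∈ 𝔸 3) (hidem : IsIdempotentOperation f) (D P : Set V)
    (hred : ∀ i, ∀ v ∈ D, v ∉ P → ∃ w, f w = v ∧ (∀ j, w j ∈ D) ∧ w i ∈ P)
    {m : ℕ} {S : Set (Fin m → V)} (hS : IsSubalgebraOfPower 𝔸 m S) (t : Fin m → V)
    (h : ∀ t' : Fin m → V, (∀ j, t j ∉ D → t' j = t j) → (∀ j, t j ∈ D → t' j ∈ D) →
      {j | t' j ∈ D ∧ t' j ∉ P}.ncard ≤ 2 → t' ∈ S) : t ∈ S := by
  classical
  induction hN : {j | t j ∈ D ∧ t j ∉ P}.ncard using Nat.strong_induction_on generalizing t with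
  | _ N ih =>
  subst hN
  by_cases hle : {j | t j ∈ D ∧ t j ∉ P}.ncard ≤ 2
  · exact h t (fun _ _ => rfl) (fun _ hj => hj) hle
  obtain ⟨B, hB, hBc⟩ := Set.exists_subset_card_eq (s := {j | t j ∈ D ∧ t j ∉ P}) (n := 3)
    (by omega)
  have hBfin : Nat.card B = 3 := by rw [← hBc]; rfl
  let e : Fin 3 ≃ B := (finCongr hBfin.symm).trans (Finite.equivFin B).symm
  have hbad : ∀ r, t (e r) ∈ D ∧ t (e r) ∉ P := fun r => hB (e r).2
  choose W hW hWD hWP using fun r => hred r (t (e r)) (hbad r).1 (hbad r).2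
  let T : Fin 3 → Fin m → V := fun i j => if hj : j ∈ B then W (e.symm ⟨j, hj⟩) i else t j
  have hTe : ∀ i r, T i (e r) = W r i := by
    intro i r
    simp [T]
  have hTn : ∀ i j, j ∉ B → T i j = t j := by
    intro i j hj
    simp [T, hj]
  have hcases : ∀ j, j ∈ B → ∃ r, (e r : Fin m) = j := fun j hj => ⟨e.symm ⟨j, hj⟩, by simp⟩
  have hft : (fun j => f fun i => T i j) = t := by
    funext j
    by_cases hj : j ∈ B
    · obtain ⟨r, rfl⟩ := hcases j hj
      simp only [hTe]
      exact hW r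
    · simp only [hTn _ j hj]
      exact hidem _
  rw [← hft]
  refine hS 3 f hf T fun i => ?_
  have hTD : ∀ j, t j ∈ D → T i j ∈ D := by
    intro j hj
    by_cases hjB : j ∈ B
    · obtain ⟨r, rfl⟩ := hcases j hjB
      rw [hTe]
      exact hWD r i
    · rwa [hTn i j hjB]
  have hTD' : ∀ j, t j ∉ D → T i j = t j := fun j hj => hTn i j fun hjB => hj (hB hjB).1
  refine ih _ ?_ (T i) ?_ rfl
  · apply Set.ncard_lt_ncard _ (Set.toFinite _)
    refine ⟨?_, fun hsub => ?_⟩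
    · intro j hj
      by_cases hjB : j ∈ B
      · exact hB hjB
      · have := hTn i j hjB
        simpa [this] using hj
    · have := (hsub (hbad i)).2
      rw [hTe] at this
      exact this (hWP i)
  · intro t' h1 h2 h3
    refine h t' (fun j hj => ?_) (fun j hj => h2 j (hTD j hj)) h3
    rw [h1 j (by rwa [hTD' j hj]), hTD' j hj]

/-- There are polynomially many tuples that differ from a constant tuple in few coordinates. -/
theorem exists_finset_few_exceptions {V : Type*} [Finite V] (v₀ : V) (d m : ℕ) (hm : 0 < m) :
    ∃ Γ : Finset (Fin m → V), Γ.card ≤ (m * Nat.card V) ^ d ∧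
      ∀ t : Fin m → V, {j | t j ≠ v₀}.ncard ≤ d → t ∈ Γ := by
  classical
  have := Fintype.ofFinite V
  let g : (Fin d → Fin m) × (Fin d → V) → Fin m → V := fun x j =>
    if h : ∃ r, x.1 r = j then x.2 h.choose else v₀
  refine ⟨Finset.univ.image g, ?_, ?_⟩
  · refine Finset.card_image_le.trans ?_
    simp [mul_pow, Nat.card_eq_fintype_card]
  · intro t ht
    have hJ : ∃ J : Fin d → Fin m, ∀ j, t j ≠ v₀ → ∃ r, J r = j := by
      let B := {j | t j ≠ v₀}
      let e : B ≃ Fin (Nat.card B) := Finite.equivFin B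
      refine ⟨fun r => if h : (r : ℕ) < Nat.card B then e.symm ⟨r, h⟩ else ⟨0, hm⟩, ?_⟩
      intro j hj
      have hlt := (e ⟨j, hj⟩).isLt
      have hle : Nat.card B ≤ d := ht
      refine ⟨⟨e ⟨j, hj⟩, by omega⟩, ?_⟩
      simp only [hlt, dite_true, Fin.eta, Equiv.symm_apply_apply]
    obtain ⟨J, hJ⟩ := hJ
    refine Finset.mem_image.2 ⟨(J, fun r => t (J r)), Finset.mem_univ _, ?_⟩
    funext j
    by_cases h : ∃ r, J r = j
    · simp only [g, h, dite_true]
      rw [h.choose_spec]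
    · simp only [g, h, dite_false]
      by_contra hne
      exact h (hJ j (Ne.symm hne))

theorem hasPGP_of_generatingNumber_le {V : Type*} {𝔸 : OperationSet V} (q d : ℕ)
    (h : ∀ m, 0 < m → generatingNumber 𝔸 m ≤ (m * q) ^ d) : HasPGP 𝔸 := by
  refine ⟨(Polynomial.X * Polynomial.C (q : ℝ)) ^ d, IsBigO.of_bound 1 ?_⟩
  filter_upwards [eventually_gt_atTop 0] with m hm
  have : (generatingNumber 𝔸 m : ℝ) ≤ ((m : ℝ) * q) ^ d := by exact_mod_cast h m hm
  simp only [Polynomial.eval_pow, Polynomial.eval_mul, Polynomial.eval_X, Polynomial.eval_C,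
    one_mul, Real.norm_eq_abs]
  rw [abs_of_nonneg (by positivity), abs_of_nonneg (by positivity)]
  exact this

theorem generatingNumber_le_card {V : Type*} {𝔸 : OperationSet V} {m : ℕ}
    {Γ : Finset (Fin m → V)}
    (h : ∀ S, (Γ : Set (Fin m → V)) ⊆ S → IsSubalgebraOfPower 𝔸 m S → ∀ t, t ∈ S) :
    generatingNumber 𝔸 m ≤ Γ.card := by
  refine Nat.sInf_le ⟨Γ, rfl, ?_⟩
  refine Set.eq_univ_of_forall fun t => ?_
  rintro S ⟨hΓ, hS⟩
  exact h S hΓ hS t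

theorem hasPGP_of_isEmpty {V : Type*} [IsEmpty V] (𝔸 : OperationSet V) : HasPGP 𝔸 := by
  refine hasPGP_of_generatingNumber_le 0 1 fun m hm => ?_
  refine (generatingNumber_le_card (Γ := ∅) fun S _ _ t => ?_).trans (by simp)
  exact isEmptyElim (t ⟨0, hm⟩)

/-- A two-stage reduction: `s` moves all but two entries of a tuple into `D`, and then `h` makes all
but two of the entries in `D` equal to `v₀`. -/
theorem hasPGP_of_reductions {V : Type*} [Finite V] {𝔸 : OperationSet V} {s h : (Fin 3 → V) → V}
    (hs : s ∈ 𝔸 3) (hsi : IsIdempotentOperation s) (hh : h ∈ 𝔸 3) (hhi : IsIdempotentOperation h)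
    (D : Set V) (v₀ : V)
    (hsred : ∀ i, ∀ v ∉ D, ∃ w, s w = v ∧ w i ∈ D)
    (hhred : ∀ i, ∀ v ∈ D, ∃ w, h w = v ∧ (∀ j, w j ∈ D) ∧ w i = v₀) : HasPGP 𝔸 := by
  refine hasPGP_of_generatingNumber_le (Nat.card V) 4 fun m hm => ?_
  obtain ⟨Γ, hΓ, hmem⟩ := exists_finset_few_exceptions v₀ 4 m hm
  refine le_trans (generatingNumber_le_card fun S hΓS hS t => ?_) hΓ
  refine mem_subalgebra_of_reduction hs hsi Set.univ D (fun i v _ hv => ?_) hS t ?_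
  · obtain ⟨w, h1, h2⟩ := hsred i v hv
    exact ⟨w, h1, fun _ => trivial, h2⟩
  intro t₁ _ _ ht₁
  refine mem_subalgebra_of_reduction hh hhi D {v₀} (fun i v hv _ => hhred i v hv) hS t₁ ?_
  intro t₂ h1 h2 h3
  refine hΓS (hmem t₂ ?_)
  have hsub : {j | t₂ j ≠ v₀} ⊆
      {j | t₁ j ∈ Set.univ ∧ t₁ j ∉ D} ∪ {j | t₂ j ∈ D ∧ t₂ j ∉ ({v₀} : Set V)} := by
    intro j hj
    by_cases hD : t₁ j ∈ D
    · exact Or.inr ⟨h2 j hD, hj⟩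
    · exact Or.inl ⟨trivial, hD⟩
  have := Set.ncard_le_ncard hsub (Set.toFinite _)
  have := Set.ncard_union_le {j | t₁ j ∈ Set.univ ∧ t₁ j ∉ D}
    {j | t₂ j ∈ D ∧ t₂ j ∉ ({v₀} : Set V)}
  omega

/-! ### The operations behind polynomial generation -/

/-- The maximum of three numbers, rounded down to the parity that most of them have. -/
def roundedMax (p q r : ℤ) : ℤ :=
  max p (max q r) - (max p (max q r) + (p % 2 + q % 2 + r % 2) / 2) % 2

/-- The maximum of three numbers, rounded up to the parity that most of them have as long as it is
less than `a`, where the loops begin. Once the maximum has passed the last loop `c` of the first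
block of loops, the value follows the first argument, truncated to `[c, ∞)`. -/
def liftMax (a c p q r : ℤ) : ℤ :=
  if max p (max q r) < a then
    max p (max q r) + (max p (max q r) + (p % 2 + q % 2 + r % 2) / 2) % 2
  else if max p (max q r) ≤ c then max p (max q r)
  else max p c

/-- The values taken by `crossing` when the first two arguments have the same parity, with
maximum `W ≤ a`: `u` clamped to `[W, c]` and, below `a`, rounded up to the parity of `W`. -/
def lowBranch (a c W u : ℤ) : ℤ :=
  if a ≤ u then min u c else max W (u + (u + W) % 2)

/-- The values taken by `crossing` when the first two arguments have different parities: `u` clamped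
to `[a, c + J]` and, above `c`, rounded down to the parity of `c + J`. -/
def highBranch (a c J u : ℤ) : ℤ :=
  if u ≤ c then max a u else c + min J (u - c - (u - c + J) % 2)

/-- An operation whose values on `p, q ≤ c` reach beyond the first block `[a, c]` of loops:
two arguments of different parity in `[0, a]` cannot simultaneously reach the same vertex below `a`
without passing a loop, and are therefore free to be sent to the right of `c`, as far as `u`
permits. Arguments `p > c` are returned unchanged. -/
def crossing (a c p q u : ℤ) : ℤ :=
  if c < p then p
  else if a < p then max p (min u c)
  else if (p + min q a) % 2 = 0 then lowBranch a c (max p (min q a)) u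
  else highBranch a c (a - max p (min q a - 1)) u

theorem majority_parity_flip {p q r p' q' r' : ℤ} (hp : p + 1 = p' ∨ p' + 1 = p)
    (hq : q + 1 = q' ∨ q' + 1 = q) (hr : r + 1 = r' ∨ r' + 1 = r) :
    (p % 2 + q % 2 + r % 2) / 2 + (p' % 2 + q' % 2 + r' % 2) / 2 = 1 := by
  have h1 : p % 2 + p' % 2 = 1 := by omega
  have h2 : q % 2 + q' % 2 = 1 := by omega
  have h3 : r % 2 + r' % 2 = 1 := by omega
  omega

theorem max_sub_max_le {p q r p' q' r' : ℤ} (hp : p ≤ p' + 1) (hq : q ≤ q' + 1)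
    (hr : r ≤ r' + 1) : max p (max q r) ≤ max p' (max q' r') + 1 := by
  omega

theorem roundedMax_adj {p q r p' q' r' : ℤ}
    (hp : p + 1 = p' ∨ p' + 1 = p) (hq : q + 1 = q' ∨ q' + 1 = q) (hr : r + 1 = r' ∨ r' + 1 = r) :
    roundedMax p q r + 1 = roundedMax p' q' r' ∨ roundedMax p' q' r' + 1 = roundedMax p q r := by
  unfold roundedMax
  have hM : max p (max q r) ≤ max p' (max q' r') + 1 :=
    max_sub_max_le (by omega) (by omega) (by omega)
  have hM' : max p' (max q' r') ≤ max p (max q r) + 1 :=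
    max_sub_max_le (by omega) (by omega) (by omega)
  have hb := majority_parity_flip hp hq hr
  clear hp hq hr
  generalize max p (max q r) = M at *
  generalize max p' (max q' r') = M' at *
  generalize (p % 2 + q % 2 + r % 2) / 2 = b at *
  generalize (p' % 2 + q' % 2 + r' % 2) / 2 = b' at *
  omega

/-- The steps available to a vertex `x ≥ 0` when no loop precedes `a`. -/
theorem PathAdj.step {lp : ℤ → Prop} {a : ℤ} (hlt : ∀ z, 0 ≤ z → z < a → ¬ lp z) {x y : ℤ}
    (hx : 0 ≤ x) (h : PathAdj lp x y) : x + 1 = y ∨ y + 1 = x ∨ (x = y ∧ a ≤ x) := by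
  rcases h with h | h | ⟨h, h'⟩
  · exact Or.inl h
  · exact Or.inr (Or.inl h)
  · exact Or.inr (Or.inr ⟨h, not_lt.1 fun hxa => hlt x hx hxa h'⟩)

theorem pathAdj_of_step {lp : ℤ → Prop} {a c : ℤ} (hlp : ∀ z, a ≤ z → z ≤ c → lp z)
    {x y : ℤ} (h : x + 1 = y ∨ y + 1 = x ∨ (x = y ∧ a ≤ x ∧ x ≤ c)) : PathAdj lp x y := by
  rcases h with h | h | ⟨h, h1, h2⟩
  · exact Or.inl h
  · exact Or.inr (Or.inl h)
  · exact Or.inr (Or.inr ⟨h, hlp _ h1 h2⟩)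

/-- Truncation below at the looped vertex `c` is an endomorphism. -/
theorem PathAdj.max_right {lp : ℤ → Prop} {c x y : ℤ} (hc : lp c) (h : PathAdj lp x y) :
    PathAdj lp (max x c) (max y c) := by
  rcases h with h | h | ⟨rfl, h⟩
  · rcases le_or_gt c x with hx | hx
    · exact Or.inl (by omega)
    · exact Or.inr (Or.inr ⟨by omega, by rwa [max_eq_right hx.le]⟩)
  · rcases le_or_gt c y with hx | hx
    · exact Or.inr (Or.inl (by omega))
    · exact Or.inr (Or.inr ⟨by omega, by rwa [max_eq_right (by omega)]⟩)
  · rcases le_or_gt c x with hx | hx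
    · exact Or.inr (Or.inr ⟨rfl, by rwa [max_eq_left hx]⟩)
    · exact Or.inr (Or.inr ⟨rfl, by rwa [max_eq_right hx.le]⟩)

theorem liftMax_adj {lp : ℤ → Prop} {a c : ℤ} (hac : a ≤ c)
    (hlt : ∀ z, 0 ≤ z → z < a → ¬ lp z) (hlp : ∀ z, a ≤ z → z ≤ c → lp z)
    {p q r p' q' r' : ℤ} (hp0 : 0 ≤ p) (hq0 : 0 ≤ q) (hr0 : 0 ≤ r)
    (hp : PathAdj lp p p') (hq : PathAdj lp q q') (hr : PathAdj lp r r') :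
    PathAdj lp (liftMax a c p q r) (liftMax a c p' q' r') := by
  have hp1 := hp.step hlt hp0
  have hq1 := hq.step hlt hq0
  have hr1 := hr.step hlt hr0
  have hM : max p (max q r) ≤ max p' (max q' r') + 1 :=
    max_sub_max_le (by omega) (by omega) (by omega)
  have hM' : max p' (max q' r') ≤ max p (max q r) + 1 :=
    max_sub_max_le (by omega) (by omega) (by omega)
  have hb : max p (max q r) < a →
      (p % 2 + q % 2 + r % 2) / 2 + (p' % 2 + q' % 2 + r' % 2) / 2 = 1 := by
    intro hlt
    simp only [max_lt_iff] at hlt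
    exact majority_parity_flip (by omega) (by omega) (by omega)
  have hpM : p ≤ max p (max q r) := le_max_left _ _
  have hpM' : p' ≤ max p' (max q' r') := le_max_left _ _
  by_cases hbig : c < max p (max q r) ∧ c < max p' (max q' r')
  · have h1 : liftMax a c p q r = max p c := by
      unfold liftMax
      rw [if_neg (by omega), if_neg (by omega)]
    have h2 : liftMax a c p' q' r' = max p' c := by
      unfold liftMax
      rw [if_neg (by omega), if_neg (by omega)]
    rw [h1, h2]
    exact hp.max_right (hlp c hac le_rfl)
  apply pathAdj_of_step hlp
  unfold liftMax
  clear hp hq hr hq1 hr1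
  generalize max p (max q r) = M at *
  generalize max p' (max q' r') = M' at *
  generalize (p % 2 + q % 2 + r % 2) / 2 = b at *
  generalize (p' % 2 + q' % 2 + r' % 2) / 2 = b' at *
  split_ifs <;> omega

theorem crossing_of_lt {a c p q u : ℤ} (h : c < p) : crossing a c p q u = p := if_pos h

theorem crossing_of_mem {a c p q u : ℤ} (h1 : a ≤ p) (h2 : p ≤ c) :
    crossing a c p q u = max p (min u c) := by
  unfold crossing
  rw [if_neg (by omega)]
  split_ifs with h3 h4
  · rfl
  · have : max p (min q a) = a := by omega
    rw [this]
    unfold lowBranch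
    split_ifs <;> omega
  · have : max p (min q a - 1) = a := by omega
    rw [this]
    unfold highBranch
    split_ifs <;> omega

theorem crossing_of_even {a c p q u : ℤ} (hac : a ≤ c) (h1 : p < a)
    (h2 : (p + min q a) % 2 = 0) :
    crossing a c p q u = lowBranch a c (max p (min q a)) u := by
  unfold crossing
  rw [if_neg (by omega), if_neg (by omega), if_pos h2]

theorem crossing_of_odd {a c p q u : ℤ} (hac : a ≤ c) (h1 : p < a)
    (h2 : (p + min q a) % 2 = 1) :
    crossing a c p q u = highBranch a c (a - max p (min q a - 1)) u := by
  unfold crossing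
  rw [if_neg (by omega), if_neg (by omega), if_neg (by omega)]

theorem lowBranch_step {a c W W' u u' : ℤ} (hac : a ≤ c) (h : W + 1 = W' ∨ W' + 1 = W)
    (hW : W ≤ a) (hW' : W' ≤ a)
    (hu : u + 1 = u' ∨ u' + 1 = u ∨ (u = u' ∧ a ≤ u)) :
    lowBranch a c W u + 1 = lowBranch a c W' u' ∨ lowBranch a c W' u' + 1 = lowBranch a c W u ∨
      (lowBranch a c W u = lowBranch a c W' u' ∧ a ≤ lowBranch a c W u ∧
        lowBranch a c W u ≤ c) := by
  unfold lowBranch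
  split_ifs <;> omega

theorem highBranch_step {a c J J' u u' : ℤ} (hac : a ≤ c) (h : J + 1 = J' ∨ J' + 1 = J)
    (hJ : 0 ≤ J) (hJ' : 0 ≤ J')
    (hu : u + 1 = u' ∨ u' + 1 = u ∨ (u = u' ∧ a ≤ u)) :
    highBranch a c J u + 1 = highBranch a c J' u' ∨
      highBranch a c J' u' + 1 = highBranch a c J u ∨
      (highBranch a c J u = highBranch a c J' u' ∧ a ≤ highBranch a c J u ∧
        highBranch a c J u ≤ c) := by
  unfold highBranch
  split_ifs <;> omega

theorem lowBranch_highBranch_step {a c W J u u' : ℤ} (hac : a ≤ c) (hW : W = a) (hJ : J = 1)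
    (hu : u + 1 = u' ∨ u' + 1 = u ∨ (u = u' ∧ a ≤ u)) :
    lowBranch a c W u + 1 = highBranch a c J u' ∨
      highBranch a c J u' + 1 = lowBranch a c W u ∨
      (lowBranch a c W u = highBranch a c J u' ∧ a ≤ lowBranch a c W u ∧
        lowBranch a c W u ≤ c) := by
  unfold lowBranch highBranch
  split_ifs <;> omega

/-- `crossing` is compatible with steps in which the first argument stays below `a`. -/
theorem crossing_step_low {a c p p' q q' u u' : ℤ} (hac : a ≤ c) (hp : p < a) (hp' : p' < a)
    (hpp : p + 1 = p' ∨ p' + 1 = p)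
    (hq : q + 1 = q' ∨ q' + 1 = q ∨ (q = q' ∧ a ≤ q))
    (hu : u + 1 = u' ∨ u' + 1 = u ∨ (u = u' ∧ a ≤ u)) :
    crossing a c p q u + 1 = crossing a c p' q' u' ∨
      crossing a c p' q' u' + 1 = crossing a c p q u ∨
      (crossing a c p q u = crossing a c p' q' u' ∧ a ≤ crossing a c p q u ∧
        crossing a c p q u ≤ c) := by
  have hq2 : min q a + 1 = min q' a ∨ min q' a + 1 = min q a ∨
    (min q a = a ∧ min q' a = a) := by omega
  have hqa : min q a ≤ a := min_le_right _ _
  have hqa' : min q' a ≤ a := min_le_right _ _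
  rcases Int.emod_two_eq_zero_or_one (p + min q a) with h | h <;>
  rcases Int.emod_two_eq_zero_or_one (p' + min q' a) with h' | h'
  · rw [crossing_of_even hac hp h, crossing_of_even hac hp' h']
    exact lowBranch_step hac (by omega) (by omega) (by omega) hu
  · rw [crossing_of_even hac hp h, crossing_of_odd hac hp' h']
    exact lowBranch_highBranch_step hac (by omega) (by omega) hu
  · rw [crossing_of_odd hac hp h, crossing_of_even hac hp' h']
    have := lowBranch_highBranch_step (c := c) (W := max p' (min q' a))
      (J := a - max p (min q a - 1)) (u := u') (u' := u) hac (by omega) (by omega) (by omega)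
    omega
  · rw [crossing_of_odd hac hp h, crossing_of_odd hac hp' h']
    exact highBranch_step hac (by omega) (by omega) (by omega) hu

/-- `crossing` is compatible with steps in which the first argument enters the loops. -/
theorem crossing_step_enter {a c q q' u u' : ℤ} (hac : a ≤ c)
    (hu : u + 1 = u' ∨ u' + 1 = u ∨ (u = u' ∧ a ≤ u)) :
    crossing a c (a - 1) q u + 1 = crossing a c a q' u' ∨
      crossing a c a q' u' + 1 = crossing a c (a - 1) q u ∨
      (crossing a c (a - 1) q u = crossing a c a q' u' ∧ a ≤ crossing a c a q' u' ∧
        crossing a c a q' u' ≤ c) := by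
  rw [crossing_of_mem le_rfl hac]
  rcases Int.emod_two_eq_zero_or_one (a - 1 + min q a) with h | h
  · rw [crossing_of_even hac (by omega) h]
    have hW : max (a - 1) (min q a) = a - 1 := by omega
    rw [hW]
    unfold lowBranch
    clear h hW
    split_ifs <;> omega
  · rw [crossing_of_odd hac (by omega) h]
    have hJ : a - max (a - 1) (min q a - 1) = 1 := by omega
    rw [hJ]
    unfold highBranch
    clear h hJ
    split_ifs <;> omega

theorem crossing_adj {lp : ℤ → Prop} {a c : ℤ} (hac : a ≤ c)
    (hlt : ∀ z, 0 ≤ z → z < a → ¬ lp z) (hlp : ∀ z, a ≤ z → z ≤ c → lp z)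
    {p q u p' q' u' : ℤ} (hp0 : 0 ≤ p) (hq0 : 0 ≤ q) (hu0 : 0 ≤ u)
    (hp : PathAdj lp p p') (hq : PathAdj lp q q') (hu : PathAdj lp u u') :
    PathAdj lp (crossing a c p q u) (crossing a c p' q' u') := by
  have hp1 := hp.step hlt hp0
  have hq1 := hq.step hlt hq0
  have hu1 := hu.step hlt hu0
  rcases lt_or_ge c p with hcp | hcp <;> rcases lt_or_ge c p' with hcp' | hcp'
  · rwa [crossing_of_lt hcp, crossing_of_lt hcp']
  · rw [crossing_of_lt hcp, crossing_of_mem (by omega) hcp']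
    exact Or.inr (Or.inl (by omega))
  · rw [crossing_of_lt hcp', crossing_of_mem (by omega) hcp]
    exact Or.inl (by omega)
  apply pathAdj_of_step hlp
  rcases lt_or_ge p a with hpa | hpa <;> rcases lt_or_ge p' a with hpa' | hpa'
  · exact crossing_step_low hac hpa hpa' (by omega) hq1 hu1
  · obtain rfl : p' = a := by omega
    obtain rfl : p = p' - 1 := by omega
    have := crossing_step_enter (q := q) (q' := q') hac hu1
    omega
  · obtain rfl : p = a := by omega
    obtain rfl : p' = p - 1 := by omega
    have := crossing_step_enter (q := q') (q' := q) (u := u') (u' := u) hac (by omega)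
    omega
  · rw [crossing_of_mem hpa hcp, crossing_of_mem hpa' hcp']
    omega

/-! ### Quasi-loop-connected paths -/

theorem roundedMax_mem {n p q r : ℤ} (hp : 0 ≤ p) (hq : 0 ≤ q) (hr : 0 ≤ r) (hpn : p < n)
    (hqn : q < n) (hrn : r < n) : 0 ≤ roundedMax p q r ∧ roundedMax p q r < n := by
  unfold roundedMax
  have h1 : 0 ≤ p % 2 ∧ p % 2 ≤ 1 ∧ p % 2 ≤ max p (max q r) := by omega
  have h2 : 0 ≤ q % 2 ∧ q % 2 ≤ 1 ∧ q % 2 ≤ max p (max q r) := by omega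
  have h3 : 0 ≤ r % 2 ∧ r % 2 ≤ 1 ∧ r % 2 ≤ max p (max q r) := by omega
  have hM : 0 ≤ max p (max q r) ∧ max p (max q r) < n := by omega
  generalize max p (max q r) = M at *
  have hb : (p % 2 + q % 2 + r % 2) / 2 = 0 ∨ 1 ≤ M := by omega
  rcases hb with hb | hb
  · rw [hb]
    omega
  · omega

theorem isIntPolymorphism_roundedMax {n : ℕ} {lp : ℤ → Prop}
    (hlp : ∀ z : ℤ, 0 ≤ z → z < n → ¬ lp z) :
    IsIntPolymorphism n lp (fun w : Fin 3 → ℤ => roundedMax (w 0) (w 1) (w 2)) where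
  mem w hw := by
    have h0 := hw 0
    have h1 := hw 1
    have h2 := hw 2
    exact roundedMax_mem h0.1 h1.1 h2.1 h0.2 h1.2 h2.2
  hom w w' hw _ h := by
    have key : ∀ j, w j + 1 = w' j ∨ w' j + 1 = w j := by
      intro j
      rcases h j with h | h | h
      · exact Or.inl h
      · exact Or.inr h
      · exact absurd h.2 (hlp _ (hw j).1 (hw j).2)
    rcases roundedMax_adj (key 0) (key 1) (key 2) with h | h
    · exact Or.inl h
    · exact Or.inr (Or.inl h)
  idem v _ _ := by
    change roundedMax v v v = v
    unfold roundedMax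
    rw [max_self, max_self, show (v % 2 + v % 2 + v % 2) / 2 = v % 2 by omega]
    omega

theorem isIntPolymorphism_liftMax {n : ℕ} {lp : ℤ → Prop} {a c : ℤ} (hac : a ≤ c) (hcn : c < n)
    (hlt : ∀ z, 0 ≤ z → z < a → ¬ lp z) (hlp : ∀ z, a ≤ z → z ≤ c → lp z) :
    IsIntPolymorphism n lp (fun w : Fin 3 → ℤ => liftMax a c (w 0) (w 1) (w 2)) where
  mem w hw := by
    have h0 := hw 0
    have h1 := hw 1
    have h2 := hw 2
    unfold liftMax
    split_ifs <;> omega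
  hom _ _ hw _ h :=
    liftMax_adj hac hlt hlp (hw 0).1 (hw 1).1 (hw 2).1 (h 0) (h 1) (h 2)
  idem v _ _ := by
    change liftMax a c v v v = v
    unfold liftMax
    rw [max_self, max_self, show (v % 2 + v % 2 + v % 2) / 2 = v % 2 by omega]
    split_ifs <;> omega

theorem crossing_mem {n a c p q u : ℤ} (ha : 0 ≤ a) (hac : a ≤ c) (hcn : c < n)
    (hp : 0 ≤ p ∧ p < n) (hu : 0 ≤ u ∧ u < n) :
    0 ≤ crossing a c p q u ∧ crossing a c p q u < n := by
  rcases lt_or_ge c p with h | h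
  · rwa [crossing_of_lt h]
  rcases lt_or_ge p a with h' | h'
  · rcases Int.emod_two_eq_zero_or_one (p + min q a) with h2 | h2
    · rw [crossing_of_even hac h' h2]
      unfold lowBranch
      split_ifs <;> omega
    · rw [crossing_of_odd hac h' h2]
      unfold highBranch
      have hJ : 0 ≤ a - max p (min q a - 1) := by omega
      generalize a - max p (min q a - 1) = J at *
      split_ifs <;> omega
  · rw [crossing_of_mem h' h]
    omega

theorem crossing_self {a c v : ℤ} (hac : a ≤ c) : crossing a c v v v = v := by
  rcases lt_or_ge c v with h | h
  · rw [crossing_of_lt h]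
  rcases lt_or_ge v a with h' | h'
  · rw [crossing_of_even hac h' (by omega)]
    unfold lowBranch
    split_ifs <;> omega
  · rw [crossing_of_mem h' h]
    omega

theorem isIntPolymorphism_crossing {n : ℕ} {lp : ℤ → Prop} {a c : ℤ} (ha : 0 ≤ a) (hac : a ≤ c)
    (hcn : c < n) (hlt : ∀ z, 0 ≤ z → z < a → ¬ lp z) (hlp : ∀ z, a ≤ z → z ≤ c → lp z) :
    IsIntPolymorphism n lp (fun w : Fin 3 → ℤ => crossing a c (w 0) (w 1) (w 2)) where
  mem _ hw := crossing_mem ha hac hcn (hw 0) (hw 2)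
  hom _ _ hw _ h :=
    crossing_adj hac hlt hlp (hw 0).1 (hw 1).1 (hw 2).1 (h 0) (h 1) (h 2)
  idem _ _ _ := crossing_self hac

/-- Every vertex on the right of `[a, c]` is reached by `crossing` from the last vertex and two
vertices of different parity at most `a`; these lie on the path if `j ≤ a`. -/
theorem crossing_surj {n a c j : ℤ} (hac : a ≤ c) (h0 : 0 < j)
    (h1 : c + j < n) : crossing a c (a - j) (a - j + 1) (n - 1) = c + j := by
  rw [crossing_of_odd hac (by omega) (by omega)]
  have hJ : a - max (a - j) (min (a - j + 1) a - 1) = j := by omega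
  rw [hJ]
  unfold highBranch
  rw [if_neg (by omega)]
  omega

theorem PathCoords.hasPGP_of_loopless {V : Type*} {E : V → V → Prop} {n : ℕ} {lp : ℤ → Prop}
    {pos : V → ℤ} (h : PathCoords E n lp pos) (hlp : ∀ z : ℤ, 0 ≤ z → z < n → ¬ lp z) :
    HasPGP (idPol E) := by
  have := h.finite
  rcases isEmpty_or_nonempty V with hV | ⟨⟨v⟩⟩
  · exact hasPGP_of_isEmpty _
  obtain ⟨v₀, hv₀⟩ := h.surj 0 le_rfl (by have := h.nonneg v; have := h.lt v; omega)
  obtain ⟨f, hf, hfF⟩ := h.exists_idPol (by norm_num) (isIntPolymorphism_roundedMax hlp)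
  refine hasPGP_of_reductions hf hf.2.2 hf hf.2.2 Set.univ v₀ (fun i v hv => (hv trivial).elim) ?_
  intro i v _
  refine ⟨fun j => if j = i then v₀ else v, ?_, fun _ => trivial, by simp⟩
  apply h.inj
  have := h.nonneg v
  rw [hfF]
  unfold roundedMax
  fin_cases i <;> simp [hv₀] <;> omega

/-- If the first block of loops is `[a, c]` and at most `a` vertices lie to its right, then `crossing`
reduces all but two entries of a tuple to `[0, c]` and `liftMax` reduces these to `0`. -/
theorem PathCoords.hasPGP_of_loops {V : Type*} {E : V → V → Prop} {n : ℕ} {lp : ℤ → Prop}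
    {pos : V → ℤ} (h : PathCoords E n lp pos) {a c : ℤ} (ha : 0 ≤ a) (hac : a ≤ c) (hcn : c < n)
    (hlt : ∀ z, 0 ≤ z → z < a → ¬ lp z) (hlp : ∀ z, a ≤ z → z ≤ c → lp z)
    (hn : (n : ℤ) - 1 - c ≤ a) : HasPGP (idPol E) := by
  have := h.finite
  obtain ⟨v₀, hv₀⟩ := h.surj 0 le_rfl (by omega)
  obtain ⟨f, hf, hfF⟩ := h.exists_idPol (by norm_num)
    (isIntPolymorphism_liftMax hac hcn hlt hlp)
  obtain ⟨s, hs, hsF⟩ := h.exists_idPol (by norm_num)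
    (isIntPolymorphism_crossing ha hac hcn hlt hlp)
  refine hasPGP_of_reductions hs hs.2.2 hf hf.2.2 {v | pos v ≤ c} v₀ ?_ ?_
  · intro i v hv
    have hv : c < pos v := not_le.1 hv
    have hvn := h.lt v
    obtain ⟨x, hx⟩ := h.surj (a - (pos v - c)) (by omega) (by omega)
    obtain ⟨y, hy⟩ := h.surj (a - (pos v - c) + 1) (by omega) (by omega)
    obtain ⟨z, hz⟩ := h.surj (n - 1) (by omega) (by omega)
    have hxyz : s ![x, y, z] = v := by
      apply h.inj
      rw [hsF]
      have := crossing_surj (n := n) (j := pos v - c) hac (by omega) (by omega)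
      simpa [hx, hy, hz] using this
    fin_cases i
    · exact ⟨_, hxyz, by simp [hx]; omega⟩
    · exact ⟨_, hxyz, by simp [hy]; omega⟩
    · refine ⟨![v, v₀, v₀], ?_, by simp [hv₀]; omega⟩
      apply h.inj
      rw [hsF]
      exact crossing_of_lt hv
  · intro i v hv
    have hv : pos v ≤ c := hv
    refine ⟨fun j => if j = i then v₀ else v, ?_, fun j => ?_, by simp⟩
    · apply h.inj
      have := h.nonneg v
      rw [hfF]
      unfold liftMax
      fin_cases i <;> simp [hv₀] <;> split_ifs <;> omega
    · change pos (if j = i then v₀ else v) ≤ c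
      split_ifs
      · omega
      · exact hv

theorem exists_least_of_pred {P : ℤ → Prop} {b z : ℤ} (hb : ∀ y, P y → b ≤ y) (hz : P z) :
    ∃ a, P a ∧ a ≤ z ∧ ∀ y, P y → a ≤ y := by
  obtain ⟨a, h1, h2⟩ := Int.exists_least_of_bdd ⟨b, hb⟩ ⟨z, hz⟩
  exact ⟨a, h1, h2 z hz, h2⟩

/-- In the form `0^a α`, the part to the right of the first loop `l ≥ a` has fewer than `l` vertices, so
that `[l, l]` can serve as the block of loops. -/
theorem hasPGP_of_isQuasiLoopConnected {V : Type*} {E : V → V → Prop}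
    (hE : IsQuasiLoopConnected E) : HasPGP (idPol E) := by
  rcases hE with ⟨a, b, α, hb, hα, hform⟩ | ⟨a, α, hα, hform⟩
  · obtain ⟨pos, h⟩ := hform.exists_pathCoords
    refine h.hasPGP_of_loops (a := a) (c := a + b - 1) (by omega) (by omega) ?_ ?_ ?_ ?_
    · simp
    · intro z h0 h1
      unfold loopAt
      rw [List.append_assoc, List.getElem?_append_left (by simp; omega),
        List.getElem?_replicate_of_lt (by omega)]
      simp
    · intro z h0 h1
      unfold loopAt
      rw [List.append_assoc, List.getElem?_append_right (by simp; omega),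
        List.getElem?_append_left (by simp; omega), List.getElem?_replicate_of_lt (by simp; omega)]
    · simp; omega
  · obtain ⟨pos, h⟩ := hform.exists_pathCoords
    set γ := List.replicate a false ++ α with hγ
    have hlen : γ.length = a + α.length := by simp [hγ]
    have hno : ∀ z : ℤ, 0 ≤ z → z < a → ¬ loopAt γ z := by
      intro z h0 h1
      unfold loopAt
      rw [hγ, List.getElem?_append_left (by simp; omega),
        List.getElem?_replicate_of_lt (by omega)]
      simp
    by_cases hex : ∃ z : ℤ, 0 ≤ z ∧ z < γ.length ∧ loopAt γ z
    · obtain ⟨z, hz⟩ := hex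
      obtain ⟨l, ⟨hl0, hl1, hl⟩, -, hmin⟩ :=
        exists_least_of_pred (P := fun z : ℤ => 0 ≤ z ∧ z < γ.length ∧ loopAt γ z)
          (b := 0) (fun y hy => hy.1) hz
      have hal : (a : ℤ) ≤ l := not_lt.1 fun hlt => hno l hl0 hlt hl
      refine h.hasPGP_of_loops (a := l) (c := l) hl0 le_rfl hl1 ?_ ?_ (by omega)
      · intro z h0 h1 hz
        have := hmin z ⟨h0, by omega, hz⟩
        omega
      · intro z h0 h1
        obtain rfl : z = l := by omega
        exact hl
    · exact h.hasPGP_of_loopless fun z h0 h1 hz => hex ⟨z, h0, h1, hz⟩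

/-! ### Projections on gaps between loops -/

/-- Polymorphisms are non-expanding for the distance to a tuple of looped vertices: walks towards
such a tuple can be extended to any length by waiting at the loops. -/
theorem IsIntPolymorphism.abs_sub_le {n : ℤ} {lp : ℤ → Prop} {k : ℕ} {F : (Fin k → ℤ) → ℤ}
    (hF : IsIntPolymorphism n lp F) {σ : Fin k → ℤ} (hσ : ∀ j, 0 ≤ σ j ∧ σ j < n)
    (hσl : ∀ j, lp (σ j)) (T : ℕ) {w : Fin k → ℤ} (hw : ∀ j, 0 ≤ w j ∧ w j < n)
    (h : ∀ j, |w j - σ j| ≤ T) : |F w - F σ| ≤ T := by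
  induction T generalizing w with
  | zero =>
    have : w = σ := by
      funext j
      have := h j
      simp at this
      omega
    simp [this]
  | succ T ih =>
    let w' : Fin k → ℤ := fun j =>
      if w j < σ j then w j + 1 else if σ j < w j then w j - 1 else w j
    have h1 : ∀ j, 0 ≤ w' j ∧ w' j < n := by
      intro j
      have := hw j
      have := hσ j
      simp only [w']
      split_ifs <;> omega
    have h2 : ∀ j, |w' j - σ j| ≤ T := by
      intro j
      have := h j
      push_cast at this
      rw [abs_le] at this ⊢
      simp only [w']
      split_ifs <;> omega
    have h3 : ∀ j, PathAdj lp (w j) (w' j) := by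
      intro j
      simp only [w']
      split_ifs with h4 h5
      · exact Or.inl rfl
      · exact Or.inr (Or.inl (by omega))
      · have : w j = σ j := by omega
        exact Or.inr (Or.inr ⟨rfl, this ▸ hσl j⟩)
    have h4 := ih h1 h2
    have h5 : F w + 1 = F w' ∨ F w' + 1 = F w ∨ F w = F w' := by
      rcases hF.hom w w' hw h1 h3 with h | h | h
      · exact Or.inl h
      · exact Or.inr (Or.inl h)
      · exact Or.inr (Or.inr h.1)
    push_cast
    rw [abs_le] at h4 ⊢
    omega

theorem IsIntPolymorphism.loop {n : ℤ} {lp : ℤ → Prop} {k : ℕ} {F : (Fin k → ℤ) → ℤ}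
    (hF : IsIntPolymorphism n lp F) {σ : Fin k → ℤ} (hσ : ∀ j, 0 ≤ σ j ∧ σ j < n)
    (hσl : ∀ j, lp (σ j)) : lp (F σ) := by
  rcases hF.hom σ σ hσ hσ fun j => Or.inr (Or.inr ⟨rfl, hσl j⟩) with h | h | h
  · omega
  · omega
  · exact h.2

/-- `x` and `y` are consecutive loops on `[0, n)` with at least one vertex in between. -/
structure IsGap (n : ℤ) (lp : ℤ → Prop) (x y : ℤ) : Prop where
  nonneg : 0 ≤ x
  lt : y < n
  add_two_le : x + 2 ≤ y
  left : lp x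
  right : lp y
  between : ∀ z, x < z → z < y → ¬ lp z

/-- `F` is the projection to its `i`-th argument on tuples over `{x, y}`. -/
def IsProjOn {k : ℕ} (F : (Fin k → ℤ) → ℤ) (x y : ℤ) (i : Fin k) : Prop :=
  ∀ σ : Fin k → ℤ, (∀ j, σ j = x ∨ σ j = y) → F σ = σ i

section gap

variable {n : ℤ} {lp : ℤ → Prop} {k : ℕ} {F : (Fin k → ℤ) → ℤ} {x y : ℤ}

theorem IsIntPolymorphism.eq_or_eq_of_gap (hF : IsIntPolymorphism n lp F) (hg : IsGap n lp x y)
    {σ : Fin k → ℤ} (hσ : ∀ j, σ j = x ∨ σ j = y) : F σ = x ∨ F σ = y := by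
  have := hg.nonneg
  have := hg.lt
  have := hg.add_two_le
  have hr : ∀ j, 0 ≤ σ j ∧ σ j < n := fun j => by rcases hσ j with h | h <;> omega
  have hl : lp (F σ) := hF.loop hr fun j => by
    rcases hσ j with h | h <;> rw [h]
    exacts [hg.left, hg.right]
  have h1 := hF.abs_sub_le (σ := fun _ => x) (fun _ => by omega) (fun _ => hg.left)
    (y - x).toNat hr (fun j => by rw [abs_le]; rcases hσ j with h | h <;> omega)
  have h2 := hF.abs_sub_le (σ := fun _ => y) (fun _ => by omega) (fun _ => hg.right)
    (y - x).toNat hr (fun j => by rw [abs_le]; rcases hσ j with h | h <;> omega)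
  rw [hF.idem x (by omega) (by omega), abs_le] at h1
  rw [hF.idem y (by omega) (by omega), abs_le] at h2
  by_contra hne
  rw [not_or] at hne
  exact hg.between (F σ) (by omega) (by omega) hl

/-- If two tuples `b` and `b'` over `{x, y}` both have a value different from that of `a`, then they
differ from `a` in a common coordinate. Otherwise the tuples one step from `a` towards `b` and
towards `b'` are adjacent, while both have as value the vertex next to `F a` inside the gap, which
carries no loop. -/
theorem IsIntPolymorphism.exists_common_change (hF : IsIntPolymorphism n lp F)
    (hg : IsGap n lp x y) {a b b' : Fin k → ℤ} (ha : ∀ j, a j = x ∨ a j = y)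
    (hb : ∀ j, b j = x ∨ b j = y) (hb' : ∀ j, b' j = x ∨ b' j = y)
    (hab : F b ≠ F a) (hab' : F b' ≠ F a) : ∃ j, b j ≠ a j ∧ b' j ≠ a j := by
  have hx0 := hg.nonneg
  have hyn := hg.lt
  have hxy := hg.add_two_le
  by_contra hno
  push Not at hno
  -- the first tuple on the walk from `a` to `b`
  let st : (Fin k → ℤ) → Fin k → ℤ := fun b j =>
    if b j = a j then a j else if a j = x then x + 1 else y - 1
  have hrange : ∀ σ : Fin k → ℤ, (∀ j, σ j = x ∨ σ j = y) → ∀ j, 0 ≤ σ j ∧ σ j < n :=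
    fun σ hσ j => by rcases hσ j with h | h <;> omega
  have hloop : ∀ σ : Fin k → ℤ, (∀ j, σ j = x ∨ σ j = y) → ∀ j, lp (σ j) := by
    intro σ hσ j
    rcases hσ j with h | h <;> rw [h]
    exacts [hg.left, hg.right]
  have hst : ∀ b j, 0 ≤ st b j ∧ st b j < n := by
    intro b j
    have := hrange a ha j
    simp only [st]
    split_ifs <;> omega
  have hval : ∀ b : Fin k → ℤ, (∀ j, b j = x ∨ b j = y) → F b ≠ F a →
      F (st b) = if F a = x then x + 1 else y - 1 := by
    intro b hb hne
    have h1 := hF.abs_sub_le (hrange a ha) (hloop a ha) 1 (hst b) (by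
      intro j
      rw [abs_le]
      rcases ha j with h | h <;> simp only [st] <;> split_ifs <;> push_cast <;> omega)
    have h2 := hF.abs_sub_le (hrange b hb) (hloop b hb) (y - x - 1).toNat (hst b) (by
      intro j
      rw [abs_le]
      rcases ha j with h | h <;> rcases hb j with h' | h' <;> simp only [st] <;>
        split_ifs <;> omega)
    rw [abs_le] at h1 h2
    have h3 := hF.eq_or_eq_of_gap hg ha
    have h4 := hF.eq_or_eq_of_gap hg hb
    split_ifs <;> omega
  have hadj : PathAdj lp (F (st b)) (F (st b')) := by
    apply hF.hom _ _ (hst b) (hst b')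
    intro j
    by_cases h : b j = a j
    · by_cases h' : b' j = a j
      · have : st b j = st b' j ∧ st b j = a j := by simp [st, h, h']
        refine Or.inr (Or.inr ⟨this.1, ?_⟩)
        rw [this.2]
        exact hloop a ha j
      · have h1 : st b j = a j := by simp [st, h]
        have h2 : st b' j = if a j = x then x + 1 else y - 1 := by simp [st, h']
        unfold PathAdj
        rcases ha j with h3 | h3 <;> split_ifs at h2 <;> omega
    · have h' := hno j h
      have h1 : st b' j = a j := by simp [st, h']
      have h2 : st b j = if a j = x then x + 1 else y - 1 := by simp [st, h]
      unfold PathAdj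
      rcases ha j with h3 | h3 <;> split_ifs at h2 <;> omega
  rw [hval b hb hab, hval b' hb' hab'] at hadj
  rcases hadj with h | h | ⟨-, h⟩
  · omega
  · omega
  · split_ifs at h
    · exact hg.between _ (by omega) (by omega) h
    · exact hg.between _ (by omega) (by omega) h

theorem IsIntPolymorphism.exists_isProjOn (hF : IsIntPolymorphism n lp F) (hg : IsGap n lp x y) :
    ∃ i, IsProjOn F x y i := by
  classical
  have hx0 := hg.nonneg
  have hyn := hg.lt
  have hxy := hg.add_two_le
  let τ : Finset (Fin k) → Fin k → ℤ := fun s j => if j ∈ s then y else x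
  have hτ : ∀ s j, τ s j = x ∨ τ s j = y := fun s j => by
    simp only [τ]; split_ifs <;> simp
  -- some coordinate is sensitive, since `F` takes both values on constant tuples
  obtain ⟨i, s, his, hne⟩ : ∃ i s, i ∉ s ∧ F (τ (insert i s)) ≠ F (τ s) := by
    by_contra hno
    push Not at hno
    have hconst : ∀ s : Finset (Fin k), F (τ s) = F (τ ∅) := by
      intro s
      induction s using Finset.induction_on with
      | empty => rfl
      | insert i s his ih => rw [hno i s his, ih]
    have h1 : F (τ ∅) = x := by
      have : τ ∅ = fun _ => x := by funext j; simp [τ]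
      rw [this, hF.idem x (by omega) (by omega)]
    have h2 : F (τ Finset.univ) = y := by
      have : τ Finset.univ = fun _ => y := by funext j; simp [τ]
      rw [this, hF.idem y (by omega) (by omega)]
    have := hconst Finset.univ
    omega
  have hx : ∀ σ : Fin k → ℤ, (∀ j, σ j = x ∨ σ j = y) → σ i = x → F σ = F (τ s) := by
    intro σ hσ hi
    by_contra hcon
    obtain ⟨j, h1, h2⟩ := hF.exists_common_change hg (hτ s) hσ (hτ (insert i s)) hcon hne
    have hji : j = i := by
      by_contra hji
      exact h2 (by simp [τ, hji])
    subst hji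
    exact h1 (by simp [τ, his, hi])
  have hy : ∀ σ : Fin k → ℤ, (∀ j, σ j = x ∨ σ j = y) → σ i = y →
      F σ = F (τ (insert i s)) := by
    intro σ hσ hi
    by_contra hcon
    obtain ⟨j, h1, h2⟩ := hF.exists_common_change hg (hτ (insert i s)) hσ (hτ s) hcon hne.symm
    have hji : j = i := by
      by_contra hji
      exact h2 (by simp [τ, hji])
    subst hji
    exact h1 (by simp [τ, hi])
  refine ⟨i, fun σ hσ => ?_⟩
  rcases hσ i with hi | hi
  · rw [hi, hx σ hσ hi, ← hx (fun _ => x) (fun _ => Or.inl rfl) rfl,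
      hF.idem x (by omega) (by omega)]
  · rw [hi, hy σ hσ hi, ← hy (fun _ => y) (fun _ => Or.inr rfl) rfl,
      hF.idem y (by omega) (by omega)]

end gap

/-- Gaps separated by a single block of loops are governed by the same coordinate. -/
theorem IsIntPolymorphism.isProjOn_adjacent {n : ℤ} {lp : ℤ → Prop} {k : ℕ}
    {F : (Fin k → ℤ) → ℤ} (hF : IsIntPolymorphism n lp F) {x₁ y₁ x₂ y₂ : ℤ}
    (hg₁ : IsGap n lp x₁ y₁) (hg₂ : IsGap n lp x₂ y₂) (hle : y₁ ≤ x₂)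
    (hl : ∀ z, y₁ ≤ z → z ≤ x₂ → lp z) {i j : Fin k} (hi : IsProjOn F x₁ y₁ i)
    (hj : IsProjOn F x₂ y₂ j) : i = j := by
  by_contra hij
  have b1 := hg₁.nonneg
  have b2 := hg₁.add_two_le
  have b3 := hg₂.add_two_le
  have b4 := hg₂.lt
  let τ : ℤ → ℤ → Fin k → ℤ := fun p q r => if r = j then q else p
  have hτ : ∀ p q, 0 ≤ p ∧ p < n → 0 ≤ q ∧ q < n → ∀ r, 0 ≤ τ p q r ∧ τ p q r < n := by
    intro p q hp hq r
    simp only [τ]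
    split_ifs
    exacts [hq, hp]
  have hτl : ∀ p q, lp p → lp q → ∀ r, lp (τ p q r) := by
    intro p q hp hq r
    simp only [τ]
    split_ifs
    exacts [hq, hp]
  have hτd : ∀ p q p' q' : ℤ, ∀ T : ℕ, |p - p'| ≤ T → |q - q'| ≤ T →
      ∀ r, |τ p q r - τ p' q' r| ≤ T := by
    intro p q p' q' T hp hq r
    simp only [τ]
    split_ifs
    exacts [hq, hp]
  -- moving the `j`-th entry through the block of loops, the value cannot cross the first gap
  have hA : ∀ d : ℕ, y₁ + d ≤ x₂ → F (τ x₁ (y₁ + d)) ≤ x₁ := by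
    intro d
    induction d with
    | zero =>
      intro _
      have := hi (τ x₁ (y₁ + (0 : ℕ))) fun r => by simp only [τ]; split_ifs <;> simp
      rw [this]
      simp [τ, hij]
    | succ d ih =>
      intro hd
      push_cast at hd ⊢
      have h1 := ih (by omega)
      have h2 := hF.abs_sub_le (hτ x₁ (y₁ + d) (by omega) (by omega))
        (hτl _ _ hg₁.left (hl _ (by omega) (by omega))) 1
        (hτ x₁ (y₁ + (d + 1)) (by omega) (by omega))
        (hτd _ _ _ _ _ (by simp) (by rw [abs_le]; push_cast; omega))
      rw [abs_le] at h2
      by_contra hgt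
      refine hg₁.between _ (by omega) (by push_cast at h2; omega)
        (hF.loop (hτ x₁ (y₁ + (d + 1)) (by omega) (by omega))
          (hτl _ _ hg₁.left (hl _ (by omega) (by omega))))
  -- symmetrically for the other entries and the second gap
  have hB : ∀ d : ℕ, y₁ ≤ x₂ - d → y₂ ≤ F (τ (x₂ - d) y₂) := by
    intro d
    induction d with
    | zero =>
      intro _
      have := hj (τ (x₂ - (0 : ℕ)) y₂) fun r => by simp only [τ]; split_ifs <;> simp
      rw [this]
      simp [τ]
    | succ d ih =>
      intro hd
      push_cast at hd ⊢
      have h1 := ih (by omega)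
      have h2 := hF.abs_sub_le (hτ (x₂ - d) y₂ (by omega) (by omega))
        (hτl _ _ (hl _ (by omega) (by omega)) hg₂.right) 1
        (hτ (x₂ - (d + 1)) y₂ (by omega) (by omega))
        (hτd _ _ _ _ _ (by rw [abs_le]; push_cast; omega) (by simp))
      rw [abs_le] at h2
      by_contra hgt
      refine hg₂.between _ (by push_cast at h2; omega) (by omega)
        (hF.loop (hτ (x₂ - (d + 1)) y₂ (by omega) (by omega))
          (hτl _ _ (hl _ (by omega) (by omega)) hg₂.right))
  have hA' : F (τ x₁ x₂) ≤ x₁ := by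
    have := hA (x₂ - y₁).toNat (by omega)
    rwa [show y₁ + ((x₂ - y₁).toNat : ℤ) = x₂ by omega] at this
  have hB' : y₂ ≤ F (τ y₁ y₂) := by
    have := hB (x₂ - y₁).toNat (by omega)
    rwa [show x₂ - ((x₂ - y₁).toNat : ℤ) = y₁ by omega] at this
  have hx₂ : lp x₂ := hg₂.left
  have hy₁ : lp y₁ := hg₁.right
  -- one step before, and one step after, the tuple `(x₁, y₂)` the values are too far apart
  have h1 := hF.abs_sub_le (hτ x₁ x₂ (by omega) (by omega)) (hτl _ _ hg₁.left hx₂)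
    (y₂ - x₂ - 1).toNat (hτ x₁ (y₂ - 1) (by omega) (by omega))
    (hτd _ _ _ _ _ (by simp) (by rw [abs_le]; omega))
  have h2 := hF.abs_sub_le (hτ y₁ y₂ (by omega) (by omega)) (hτl _ _ hy₁ hg₂.right)
    (y₁ - x₁ - 1).toNat (hτ (x₁ + 1) y₂ (by omega) (by omega))
    (hτd _ _ _ _ _ (by rw [abs_le]; omega) (by simp))
  have h3 : PathAdj lp (F (τ x₁ (y₂ - 1))) (F (τ (x₁ + 1) y₂)) := by
    apply hF.hom _ _ (hτ _ _ (by omega) (by omega)) (hτ _ _ (by omega) (by omega))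
    intro r
    simp only [τ]
    split_ifs
    · exact Or.inl (by omega)
    · exact Or.inl rfl
  rw [abs_le] at h1 h2
  rcases h3 with h3 | h3 | ⟨h3, -⟩ <;> omega

theorem exists_greatest_of_pred {P : ℤ → Prop} {b z : ℤ} (hb : ∀ y, P y → y ≤ b) (hz : P z) :
    ∃ a, P a ∧ z ≤ a ∧ ∀ y, P y → y ≤ a := by
  obtain ⟨a, h1, h2⟩ := Int.exists_greatest_of_bdd ⟨b, hb⟩ ⟨z, hz⟩
  exact ⟨a, h1, h2 z hz, h2⟩

/-- All gaps are governed by the same coordinate. -/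
theorem IsIntPolymorphism.isProjOn_of_isProjOn {n : ℤ} {lp : ℤ → Prop} {k : ℕ}
    {F : (Fin k → ℤ) → ℤ} (hF : IsIntPolymorphism n lp F) {x₀ y₀ x y : ℤ}
    (hg₀ : IsGap n lp x₀ y₀) (hg : IsGap n lp x y) (hle : x₀ ≤ x) {i : Fin k}
    (hi : IsProjOn F x₀ y₀ i) : IsProjOn F x y i := by
  have c0 := hg₀.nonneg
  have c1 := hg₀.add_two_le
  have c2 := hg.add_two_le
  have c3 := hg.lt
  -- each loop is preceded by its block of loops and by a gap governed by `i`
  have key : ∀ d : ℕ, y₀ + d < n → lp (y₀ + d) → ∃ x' y', IsGap n lp x' y' ∧ IsProjOn F x' y' i ∧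
      y' ≤ y₀ + d ∧ ∀ z, y' ≤ z → z ≤ y₀ + d → lp z := by
    intro d
    induction d using Nat.strong_induction_on with
    | _ d ih =>
    intro hdn hd
    rcases Nat.eq_zero_or_pos d with rfl | hdpos
    · refine ⟨x₀, y₀, hg₀, hi, by simp, fun z h1 h2 => ?_⟩
      obtain rfl : z = y₀ := by push_cast at h2; omega
      exact hg₀.right
    obtain ⟨u, ⟨hu1, hul⟩, hu0, hmax⟩ :=
      exists_greatest_of_pred (P := fun z => z < y₀ + d ∧ lp z) (b := y₀ + d) (z := y₀)
        (fun z hz => hz.1.le) ⟨by omega, hg₀.right⟩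
    have hue : y₀ + ((u - y₀).toNat : ℤ) = u := by omega
    obtain ⟨x', y', hg', hi', hy', hl'⟩ := ih (u - y₀).toNat (by omega) (by omega)
      (by rwa [hue])
    rw [hue] at hy' hl'
    rcases eq_or_lt_of_le (show u + 1 ≤ y₀ + d by omega) with hs | hs
    · refine ⟨x', y', hg', hi', by omega, fun z h1 h2 => ?_⟩
      rcases eq_or_lt_of_le h2 with h2 | h2
      · rwa [h2]
      · exact hl' z h1 (by omega)
    · have hgap : IsGap n lp u (y₀ + d) := by
        refine ⟨by omega, hdn, by omega, hul, hd, fun z h1 h2 hz => ?_⟩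
        have := hmax z ⟨h2, hz⟩
        omega
      obtain ⟨j, hj⟩ := hF.exists_isProjOn hgap
      obtain rfl := hF.isProjOn_adjacent hg' hgap hy' hl' hi' hj
      refine ⟨u, y₀ + d, hgap, hj, le_rfl, fun z h1 h2 => ?_⟩
      rwa [le_antisymm h2 h1]
  rcases eq_or_lt_of_le hle with rfl | hlt
  · have : y = y₀ := by
      rcases lt_trichotomy y y₀ with h | h | h
      · exact absurd hg.right (hg₀.between y (by omega) h)
      · exact h
      · exact absurd hg₀.right (hg.between y₀ (by omega) h)
    rwa [this]
  · have hyx : y₀ ≤ x := not_lt.1 fun h => hg₀.between x hlt h hg.left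
    have hxe : y₀ + ((x - y₀).toNat : ℤ) = x := by omega
    obtain ⟨x', y', hg', hi', hy', hl'⟩ := key (x - y₀).toNat (by omega)
      (by rw [hxe]; exact hg.left)
    rw [hxe] at hy' hl'
    obtain ⟨j, hj⟩ := hF.exists_isProjOn hg
    obtain rfl := hF.isProjOn_adjacent hg' hg hy' hl' hi' hj
    exact hj

/-- If `[l, c]` is a block of loops followed by the gap `(c, e)` governed by the `i`-th coordinate,
and the part of the path on the right of `c` has more than `l` vertices, then the value `n - 1` is
only taken on tuples whose `i`-th entry is `n - 1`: if it is not, then each entry can walk in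
`n - 2 - c` steps to `[l, c]`, or to `e` if it is `n - 1`, where the value is at most `c`. -/
theorem IsIntPolymorphism.ne_last {n : ℤ} {lp : ℤ → Prop} {k : ℕ} {F : (Fin k → ℤ) → ℤ}
    (hF : IsIntPolymorphism n lp F) {l c e : ℤ} (hl0 : 0 ≤ l) (hlc : l ≤ c)
    (hl : ∀ z, l ≤ z → z ≤ c → lp z) (hg : IsGap n lp c e) (hn : l + c + 2 ≤ n) {i : Fin k}
    (hi : IsProjOn F c e i) {w : Fin k → ℤ} (hw : ∀ j, 0 ≤ w j ∧ w j < n) (hwi : w i ≠ n - 1) :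
    F w ≠ n - 1 := by
  have hce := hg.add_two_le
  have hen := hg.lt
  have hblock : ∀ d : ℕ, ∀ σ : Fin k → ℤ, (∀ j, (l ≤ σ j ∧ σ j ≤ c ∧ c - d ≤ σ j) ∨ σ j = e) →
      σ i ≤ c → F σ ≤ c := by
    intro d
    induction d with
    | zero =>
      intro σ hσ hσi
      rw [hi σ fun j => ?_]
      · exact hσi
      · have := hσ j
        push_cast at this
        omega
    | succ d ih =>
      intro σ hσ hσi
      let σ' : Fin k → ℤ := fun j => if σ j ≤ c then max (σ j) (c - d) else e
      have hσ' : ∀ j, (l ≤ σ' j ∧ σ' j ≤ c ∧ c - d ≤ σ' j) ∨ σ' j = e := by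
        intro j
        have := hσ j
        simp only [σ']
        split_ifs <;> omega
      have hr : ∀ σ : Fin k → ℤ, ∀ d : ℤ,
          (∀ j, (l ≤ σ j ∧ σ j ≤ c ∧ d ≤ σ j) ∨ σ j = e) → ∀ j, 0 ≤ σ j ∧ σ j < n := by
        intro σ d hσ j
        have := hσ j
        omega
      have hll : ∀ σ : Fin k → ℤ, ∀ d : ℤ,
          (∀ j, (l ≤ σ j ∧ σ j ≤ c ∧ d ≤ σ j) ∨ σ j = e) → ∀ j, lp (σ j) := by
        intro σ d hσ j
        rcases hσ j with h | h
        · exact hl _ h.1 h.2.1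
        · rw [h]
          exact hg.right
      have h1 := ih σ' hσ' (by simp only [σ']; rw [if_pos hσi]; omega)
      have h2 := hF.abs_sub_le (hr σ' _ hσ') (hll σ' _ hσ') 1 (hr σ _ hσ) (by
        intro j
        have := hσ j
        push_cast at this
        rw [abs_le]
        simp only [σ']
        split_ifs <;> push_cast <;> omega)
      rw [abs_le] at h2
      by_contra hgt
      exact hg.between _ (by omega) (by push_cast at h2; omega)
        (hF.loop (hr σ _ hσ) (hll σ _ hσ))
  let w' : Fin k → ℤ := fun j => if w j = n - 1 then e else max l (min (w j) c)
  have hw' : ∀ j, (l ≤ w' j ∧ w' j ≤ c ∧ c - (c - l).toNat ≤ w' j) ∨ w' j = e := by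
    intro j
    simp only [w']
    split_ifs <;> omega
  have h1 := hblock _ w' hw' (by simp only [w']; rw [if_neg hwi]; omega)
  have h2 := hF.abs_sub_le (σ := w') (w := w) (fun j => by have := hw' j; omega)
    (fun j => by
      rcases hw' j with h | h
      · exact hl _ h.1 h.2.1
      · rw [h]
        exact hg.right)
    (n - 2 - c).toNat hw (fun j => by
      have := hw j
      rw [abs_le]
      simp only [w']
      split_ifs <;> omega)
  rw [abs_le] at h2
  omega

/-! ### Paths that are not quasi-loop-connected -/

theorem PathCoords.isOfForm_append_tail {V : Type*} {E : V → V → Prop} {n : ℕ} {lp : ℤ → Prop}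
    {pos : V → ℤ} (h : PathCoords E n lp pos) (γ : List Bool) (hle : γ.length ≤ n)
    (hγ : ∀ z : ℤ, 0 ≤ z → z < γ.length → (lp z ↔ loopAt γ z)) :
    ∃ α : List Bool, α.length = n - γ.length ∧ IsOfForm E (γ ++ α) := by
  classical
  refine ⟨List.ofFn fun i : Fin (n - γ.length) => decide (lp ((γ.length : ℤ) + (i : ℕ))), by simp,
    h.isOfForm (by simp; omega) fun z h0 h1 => ?_⟩
  rcases lt_or_ge z γ.length with hz | hz
  · rw [hγ z h0 hz]
    unfold loopAt
    rw [List.getElem?_append_left (by omega)]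
  · unfold loopAt
    rw [List.getElem?_append_right (by omega), List.getElem?_ofFn, dif_pos (by omega)]
    rw [show (γ.length : ℤ) + ((z.toNat - γ.length : ℕ) : ℤ) = z by omega]
    simp

theorem PathCoords.isQuasiLoopConnected_of_half {V : Type*} {E : V → V → Prop} {n : ℕ}
    {lp : ℤ → Prop} {pos : V → ℤ} (h : PathCoords E n lp pos)
    (hlp : ∀ z : ℤ, 0 ≤ z → z < ((n + 1) / 2 : ℕ) → ¬ lp z) : IsQuasiLoopConnected E := by
  obtain ⟨α, hα, hf⟩ := h.isOfForm_append_tail (List.replicate ((n + 1) / 2) false)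
    (by simp; omega) (by
      intro z h0 h1
      rw [List.length_replicate] at h1
      unfold loopAt
      rw [List.getElem?_replicate_of_lt (by omega)]
      simpa using hlp z h0 h1)
  rw [List.length_replicate] at hα
  exact Or.inr ⟨(n + 1) / 2, α, by omega, hf⟩

theorem PathCoords.isQuasiLoopConnected_of_block {V : Type*} {E : V → V → Prop} {n : ℕ}
    {lp : ℤ → Prop} {pos : V → ℤ} (h : PathCoords E n lp pos) {l c : ℤ} (hl0 : 0 ≤ l)
    (hlt : ∀ z, 0 ≤ z → z < l → ¬ lp z) (hl : ∀ z, l ≤ z → z ≤ c → lp z)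
    (hn : (n : ℤ) ≤ l + c + 1) : IsQuasiLoopConnected E := by
  rcases le_or_gt (n : ℤ) (2 * l) with h2 | h2
  · exact h.isQuasiLoopConnected_of_half fun z h0 h1 => hlt z h0 (by omega)
  obtain ⟨a, rfl⟩ := Int.eq_ofNat_of_zero_le hl0
  obtain ⟨b, hb⟩ : ∃ b : ℕ, 2 * a + b = n := ⟨n - 2 * a, by omega⟩
  obtain ⟨α, hα, hf⟩ := h.isOfForm_append_tail (List.replicate a false ++ List.replicate b true)
    (by simp; omega) (by
      intro z h0 h1
      rw [List.length_append, List.length_replicate, List.length_replicate] at h1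
      unfold loopAt
      rcases lt_or_ge z a with hz | hz
      · rw [List.getElem?_append_left (by simp; omega),
          List.getElem?_replicate_of_lt (by omega)]
        simpa using hlt z h0 hz
      · rw [List.getElem?_append_right (by simp; omega),
          List.getElem?_replicate_of_lt (by simp; omega)]
        simpa using hl z hz (by omega))
  rw [List.length_append, List.length_replicate, List.length_replicate] at hα
  exact Or.inl ⟨a, b, α, by omega, by omega, hf⟩

/-- On a path that is not quasi-loop-connected, the first block `[l, c]` of loops is followed by a
gap, and more than `l` vertices lie on its right. -/
theorem PathCoords.exists_first_gap {V : Type*} {E : V → V → Prop} {n : ℕ} {lp : ℤ → Prop}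
    {pos : V → ℤ} (h : PathCoords E n lp pos) (hE : ¬ IsQuasiLoopConnected E) :
    ∃ l c e, 0 ≤ l ∧ l ≤ c ∧ (∀ z, l ≤ z → z ≤ c → lp z) ∧ IsGap n lp c e ∧ l + c + 2 ≤ n ∧
      ∀ x y, IsGap n lp x y → c ≤ x := by
  have hex : ∃ z : ℤ, 0 ≤ z ∧ z < n ∧ lp z := by
    by_contra hno
    push Not at hno
    exact hE (h.isQuasiLoopConnected_of_half fun z h0 h1 => hno z h0 (by omega))
  obtain ⟨z₀, hz₀⟩ := hex
  obtain ⟨l, ⟨hl0, hln, hl⟩, -, hmin⟩ :=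
    exists_least_of_pred (P := fun z : ℤ => 0 ≤ z ∧ z < n ∧ lp z) (b := 0) (fun y hy => hy.1) hz₀
  have hlt : ∀ z, 0 ≤ z → z < l → ¬ lp z := fun z h0 h1 hz => by
    have := hmin z ⟨h0, by omega, hz⟩
    omega
  obtain ⟨c, ⟨hcn, hc⟩, hlc, hmax⟩ := exists_greatest_of_pred
    (P := fun z : ℤ => z < n ∧ ∀ y, l ≤ y → y ≤ z → lp y) (b := n) (z := l)
    (fun y hy => hy.1.le) ⟨hln, fun y h1 h2 => by rwa [le_antisymm h2 h1]⟩
  have hn : l + c + 2 ≤ n := by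
    by_contra hn
    exact hE (h.isQuasiLoopConnected_of_block hl0 hlt hc (by omega))
  have hc1 : ¬ lp (c + 1) := by
    intro hc1
    have := hmax (c + 1) ⟨by omega, fun y h1 h2 => by
      rcases eq_or_lt_of_le h2 with h3 | h3
      · rwa [h3]
      · exact hc y h1 (by omega)⟩
    omega
  have hex' : ∃ z : ℤ, c < z ∧ z < n ∧ lp z := by
    by_contra hno
    push Not at hno
    -- with a single block of loops, the path is quasi-loop-connected when read backwards
    refine hE (h.reverse.isQuasiLoopConnected_of_block (l := n - 1 - c) (c := n - 1 - l)
      (by omega) (fun z h1 h2 => hno _ (by omega) (by omega))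
      (fun z h1 h2 => hc _ (by omega) (by omega)) (by omega))
  obtain ⟨z₁, hz₁⟩ := hex'
  obtain ⟨e, ⟨hce, hen, he⟩, -, hmin'⟩ :=
    exists_least_of_pred (P := fun z : ℤ => c < z ∧ z < n ∧ lp z) (b := c)
      (fun y hy => hy.1.le) hz₁
  have hne : e ≠ c + 1 := fun heq => hc1 (heq ▸ he)
  refine ⟨l, c, e, hl0, hlc, hc, ⟨by omega, hen, by omega, hc c hlc le_rfl, he, ?_⟩, hn, ?_⟩
  · intro z h1 h2 hz
    have := hmin' z ⟨h1, by omega, hz⟩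
    omega
  · intro x y hg
    by_contra hxc
    have h1 := hg.nonneg
    have h2 := hg.add_two_le
    have h3 := hg.lt
    have hlx : l ≤ x := hmin x ⟨h1, by omega, hg.left⟩
    exact hg.between (x + 1) (by omega) (by omega) (hc _ (by omega) (by omega))

/-- On a path that is not quasi-loop-connected, each idempotent polymorphism takes either end of the
path as a value only when its argument at a fixed coordinate is that end. -/
theorem PathCoords.exists_coordinate_of_ends {V : Type*} {E : V → V → Prop} {n : ℕ}
    {lp : ℤ → Prop} {pos : V → ℤ} (h : PathCoords E n lp pos) (hE : ¬ IsQuasiLoopConnected E)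
    {k : ℕ} {f : (Fin k → V) → V} (hf : f ∈ idPol E k) :
    ∃ i, ∀ w, (pos (f w) = 0 → pos (w i) = 0) ∧ (pos (f w) = n - 1 → pos (w i) = n - 1) := by
  obtain ⟨l, c, e, hl0, hlc, hl, hg, hn, hfirst⟩ := h.exists_first_gap hE
  obtain ⟨l', c', e', hl0', hlc', hl', hg', hn', -⟩ := h.reverse.exists_first_gap hE
  obtain ⟨F, hF, hFf⟩ := h.exists_isIntPolymorphism hf
  obtain ⟨F', hF', hFf'⟩ := h.reverse.exists_isIntPolymorphism hf
  obtain ⟨i, hi⟩ := hF.exists_isProjOn hg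
  have a1 := hg'.nonneg
  have a2 := hg'.add_two_le
  have a3 := hg'.lt
  have hglast : IsGap n lp (n - 1 - e') (n - 1 - c') :=
    ⟨by omega, by omega, by omega, hg'.right, hg'.left, fun z h1 h2 hz =>
      hg'.between (n - 1 - z) (by omega) (by omega) (by simpa using hz)⟩
  have hlast := hF.isProjOn_of_isProjOn hg hglast (hfirst _ _ hglast) hi
  have hi' : IsProjOn F' c' e' i := by
    intro σ hσ
    have hw : ∀ j, ∃ v, pos v = n - 1 - σ j := fun j => by
      have := hσ j
      exact h.surj _ (by omega) (by omega)
    choose w hw using hw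
    have h1 : σ = fun j => n - 1 - pos (w j) := by
      funext j
      rw [hw]
      ring
    have h2 := hlast (fun j => pos (w j)) fun j => by
      have := hσ j
      have := hw j
      omega
    rw [hFf] at h2
    rw [h1, hFf' w, h2]
  refine ⟨i, fun w => ⟨fun h0 => ?_, fun h1 => ?_⟩⟩
  · by_contra hne
    refine hF'.ne_last hl0' hlc' hl' hg' hn' hi' (w := fun j => n - 1 - pos (w j))
      (fun j => ⟨h.reverse.nonneg _, h.reverse.lt _⟩) (by omega) ?_
    rw [hFf', h0, sub_zero]
  · by_contra hne
    refine hF.ne_last hl0 hlc hl hg hn hi (w := fun j => pos (w j))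
      (fun j => ⟨h.nonneg _, h.lt _⟩) hne ?_
    rw [hFf, h1]

/-- If every operation takes each of two values `v₀` and `v₁` only when its argument at a fixed
coordinate has that value, then the complement of any tuple over `{v₀, v₁}` is a subalgebra, so that
generating sets contain all these tuples. -/
theorem two_pow_le_generatingNumber {V : Type*} [Finite V] {𝔸 : OperationSet V} {v₀ v₁ : V}
    (hne : v₀ ≠ v₁)
    (h : ∀ k, ∀ f ∈ 𝔸 k, ∃ i, ∀ w, (f w = v₀ → w i = v₀) ∧ (f w = v₁ → w i = v₁)) (m : ℕ) :
    2 ^ m ≤ generatingNumber 𝔸 m := by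
  classical
  have := Fintype.ofFinite V
  have hnonempty : {c : ℕ | ∃ Γ : Finset (Fin m → V), Γ.card = c ∧
      GeneratesPower 𝔸 m (Γ : Set (Fin m → V))}.Nonempty := by
    refine ⟨_, Finset.univ, rfl, Set.eq_univ_of_forall fun t => ?_⟩
    rintro S ⟨hS, -⟩
    exact hS (by simp)
  obtain ⟨Γ, hcard, hgen⟩ := Nat.sInf_mem hnonempty
  change 2 ^ m ≤ sInf _
  rw [← hcard]
  let g : (Fin m → Bool) → Fin m → V := fun b j => if b j then v₁ else v₀
  have hg : Function.Injective g := by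
    intro b b' hbb
    funext j
    have := congrFun hbb j
    simp only [g] at this
    cases hb : b j <;> cases hb' : b' j <;> simp_all
  have hmem : ∀ b, g b ∈ Γ := by
    intro b
    by_contra hb
    have hin : g b ∈ ⋂₀ {S : Set (Fin m → V) | (Γ : Set (Fin m → V)) ⊆ S ∧
        IsSubalgebraOfPower 𝔸 m S} := by
      rw [show (⋂₀ {S : Set (Fin m → V) | (Γ : Set (Fin m → V)) ⊆ S ∧
        IsSubalgebraOfPower 𝔸 m S}) = Set.univ from hgen]
      trivial
    refine hin {g b}ᶜ ⟨fun t ht hteq => ?_, ?_⟩ rfl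
    · rw [Set.mem_singleton_iff] at hteq
      exact hb (hteq ▸ ht)
    · intro k f hf t ht heq
      obtain ⟨i, hi⟩ := h k f hf
      refine ht i ?_
      rw [Set.mem_singleton_iff] at heq ⊢
      funext j
      have hj : f (fun i => t i j) = g b j := congrFun heq j
      have hij := hi fun i => t i j
      by_cases hbj : b j
      · rw [show g b j = v₁ by simp [g, hbj]] at hj ⊢
        exact hij.2 hj
      · rw [show g b j = v₀ by simp [g, hbj]] at hj ⊢
        exact hij.1 hj
  calc 2 ^ m = (Finset.univ.image g).card := by
        rw [Finset.card_image_of_injective _ hg]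
        simp
    _ ≤ Γ.card := Finset.card_le_card fun t ht => by
        obtain ⟨b, -, rfl⟩ := Finset.mem_image.1 ht
        exact hmem b

theorem hasEGP_of_not_isQuasiLoopConnected {V : Type*} {E : V → V → Prop}
    (hpath : IsPartiallyReflexivePath E) (hE : ¬ IsQuasiLoopConnected E) : HasEGP (idPol E) := by
  obtain ⟨γ, hγ⟩ := hpath
  obtain ⟨pos, h⟩ := hγ.exists_pathCoords
  have := h.finite
  obtain ⟨l, c, e, hl0, hlc, -, -, hn, -⟩ := h.exists_first_gap hE
  obtain ⟨v₀, hv₀⟩ := h.surj 0 le_rfl (by omega)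
  obtain ⟨v₁, hv₁⟩ := h.surj (γ.length - 1) (by omega) (by omega)
  have hne : v₀ ≠ v₁ := by
    rintro rfl
    omega
  refine ⟨2, one_lt_two, IsBigO.of_bound 1 (Eventually.of_forall fun m => ?_)⟩
  have hle := two_pow_le_generatingNumber (𝔸 := idPol E) hne (fun k f hf => by
    obtain ⟨i, hi⟩ := h.exists_coordinate_of_ends hE hf
    refine ⟨i, fun w => ⟨fun hw => h.inj ?_, fun hw => h.inj ?_⟩⟩
    · rw [hv₀]
      exact (hi w).1 (by rw [hw, hv₀])
    · rw [hv₁]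
      exact (hi w).2 (by rw [hw, hv₁])) m
  have hle' : (2 : ℝ) ^ m ≤ generatingNumber (idPol E) m := by exact_mod_cast hle
  rw [one_mul, Real.norm_eq_abs, Real.norm_eq_abs, abs_of_nonneg (by positivity),
    abs_of_nonneg (by positivity)]
  exact hle'

theorem mainTheorem1 {V : Type*} (E : V → V → Prop) (hE : IsPartiallyReflexivePath E) :
    (IsQuasiLoopConnected E → HasPGP (idPol E)) ∧
      (¬ IsQuasiLoopConnected E → HasEGP (idPol E)) :=
  ⟨hasPGP_of_isQuasiLoopConnected, hasEGP_of_not_isQuasiLoopConnected hE⟩
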